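/- An integral residuated lattice is an algebra $\mathbf G=(G;\wedge,\vee,\cdot,\backslash,/,e)$ such that $(G;\wedge,\vee)$ is a lattice, $(G;\cdot,e)$ is a monoid, $x\cdot y\le z \iff y\le x\backslash z\iff x\le z/y$ for all $x,y,z\in G$, and $x\le e$ for all $x\in G$. A variety of integral residuated lattices is a class of integral residuated lattices closed under homomorphic images, subalgebras and direct products; the variety generated by a class is the least variety containing it; and the varietal join $\bigvee_n\mathsf V_n$ of varieties $\mathsf V_n$ is the least variety containing every $\mathsf V_n$. Let $I_1\subseteq I_0$ be sets, let $\lambda\colon I_1\to I_0$ be an injective map, and put $I_{n+1}=\{i\in I_n\colon \lambda(i)\in I_n\}$ for $n\ge 1$, so that $\lambda^{n}$ maps $I_{m+n}$ into $I_m$. For an integral residuated lattice $\mathbf G$, the kite $K^\lambda_{I_0,I_1}(\mathbf G)$ is the integral residuated lattice with universe the disjoint union $\biguplus_{n\ge 0}G^{I_n}$, ordered by $\langle x_i\colon i\in I_m\rangle\le\langle y_i\colon i\in I_n\rangle$ iff $n<m$, or $n=m$ and $x_i\le y_i$ for all $i\in I_n$; with unit $1=\langle e\colon i\in I_0\rangle$;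 with product $$\langle x_i\colon i\in I_m\rangle\cdot\langle y_i\colon i\in I_n\rangle=\langle x_{\lambda^n(i)}\,y_i\colon i\in I_{m+n}\rangle;$$ and, for $x=\langle x_i\colon i\in I_m\rangle$ and $y=\langle y_i\colon i\in I_n\rangle$, with the following divisions: * right division: $y/x=1$ if $m>n$; if $m\le n$, then $y/x\in G^{I_{n-m}}$ has coordinate $y_j/x_j$ at $i=\lambda^m(j)$ with $j\in I_n$, and coordinate $e$ at each $i\in I_{n-m}\setminus\lambda^m(I_n)$; * left division: $y\backslash x=1$ if $n>m$; if $n\le m$, then $y\backslash x\in G^{I_{m-n}}$ has coordinate $y_{\lambda^{m-n}(i)}\backslash x_i$ at $i\in I_m$, and coordinate $e$ at each $i\in I_{m-n}\setminus I_m$. The kite $K^\lambda_{I_0,I_1}(\mathbf G)$ is called $n$-dimensional if $I_0$ is finite with exactly $n$ elements. Let $\mathsf K$ be the variety of integral residuated lattices generated by all kites and, for each integer $n\ge 0$, let $\mathsf K_n$ be the variety of integral residuated lattices generated by all $n$-dimensional kites. Then $$\mathsf K=\bigvee_{n=0}^{\infty}\mathsf K_n .$$ -/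

import Mathlib

universe u

/-- An integral residuated lattice `(G; ∧, ∨, ·, \, /, e)`: a lattice and a monoid with
`x * y ≤ z ↔ y ≤ x \ z ↔ x ≤ z / y`, whose unit is the top element.
`ldiv x z` is `x \ z` and `rdiv z y` is `z / y`. Commutativity is not assumed. -/
class IntegralResiduatedLattice (G : Type u) extends Lattice G, Monoid G where
  ldiv : G → G → G
  rdiv : G → G → G
  mul_le_iff_le_ldiv : ∀ x y z : G, x * y ≤ z ↔ y ≤ ldiv x z
  mul_le_iff_le_rdiv : ∀ x y z : G, x * y ≤ z ↔ x ≤ rdiv z y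
  le_one' : ∀ x : G, x ≤ 1

open IntegralResiduatedLattice

/-- Bundled integral residuated lattices. -/
structure IRL : Type (u + 1) where
  carrier : Type u
  [inst : IntegralResiduatedLattice carrier]

attribute [instance] IRL.inst

/-- Homomorphisms of integral residuated lattices: maps preserving all six operations. -/
structure IRLHom (A B : Type u) [IntegralResiduatedLattice A] [IntegralResiduatedLattice B] where
  toFun : A → B
  map_inf : ∀ x y, toFun (x ⊓ y) = toFun x ⊓ toFun y
  map_sup : ∀ x y, toFun (x ⊔ y) = toFun x ⊔ toFun y
  map_mul : ∀ x y, toFun (x * y) = toFun x * toFun y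
  map_ldiv : ∀ x y, toFun (ldiv x y) = ldiv (toFun x) (toFun y)
  map_rdiv : ∀ x y, toFun (rdiv x y) = rdiv (toFun x) (toFun y)
  map_one : toFun 1 = 1

/-- Direct products, with coordinatewise operations. -/
instance piIRL {ι : Type u} (A : ι → Type u) [∀ i, IntegralResiduatedLattice (A i)] :
    IntegralResiduatedLattice (∀ i, A i) where
  ldiv x y := fun i => ldiv (x i) (y i)
  rdiv x y := fun i => rdiv (x i) (y i)
  mul_le_iff_le_ldiv x y z := forall_congr' fun i => mul_le_iff_le_ldiv (x i) (y i) (z i)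
  mul_le_iff_le_rdiv x y z := forall_congr' fun i => mul_le_iff_le_rdiv (x i) (y i) (z i)
  le_one' x := fun i => le_one' (x i)

/-- A variety of integral residuated lattices: a class closed under homomorphic images,
subalgebras (given as injective homomorphisms, so that isomorphic copies are included)
and direct products. -/
@[ext]
structure IRLVariety : Type (u + 1) where
  algebras : Set IRL.{u}
  image_mem : ∀ (A B : IRL.{u}) (f : IRLHom A.carrier B.carrier),
    Function.Surjective f.toFun → A ∈ algebras → B ∈ algebras
  sub_mem : ∀ (A B : IRL.{u}) (f : IRLHom A.carrier B.carrier),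
    Function.Injective f.toFun → B ∈ algebras → A ∈ algebras
  prod_mem : ∀ (ι : Type u) (A : ι → IRL.{u}), (∀ i, A i ∈ algebras) →
    IRL.mk (∀ i, (A i).carrier) ∈ algebras

namespace IRLVariety

/-- Varieties are ordered by inclusion. -/
instance : PartialOrder IRLVariety.{u} where
  le V W := V.algebras ⊆ W.algebras
  le_refl V := Set.Subset.refl V.algebras
  le_trans _ _ _ h k := Set.Subset.trans h k
  le_antisymm _ _ h k := IRLVariety.ext (Set.Subset.antisymm h k)

/-- The intersection of a family of varieties. -/
instance : InfSet IRLVariety.{u} where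
  sInf S :=
    { algebras := {A | ∀ V ∈ S, A ∈ V.algebras}
      image_mem := fun A B f hf hA V hV => V.image_mem A B f hf (hA V hV)
      sub_mem := fun A B f hf hB V hV => V.sub_mem A B f hf (hB V hV)
      prod_mem := fun ι A hA V hV => V.prod_mem ι A fun i => hA i V hV }

/-- Varieties form a complete lattice whose infima are intersections; the join `⨆` of a family of
varieties is the least variety containing all of them. -/
instance : CompleteLattice IRLVariety.{u} :=
  completeLatticeOfInf IRLVariety.{u} fun _ =>
    ⟨fun V hV _ hA => hA V hV, fun _ hW _ hA _ hV => hW hV hA⟩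

/-- The variety generated by a class of integral residuated lattices: the least variety
that contains the class. -/
def generatedBy (C : Set IRL.{u}) : IRLVariety.{u} :=
  sInf {V | C ⊆ V.algebras}

end IRLVariety

/-- The index data of a kite: a set `I0`, a subset `I1` and an injection `lam : I1 → I0`. -/
structure KiteFrame : Type (u + 1) where
  I0 : Type u
  I1 : Set I0
  lam : I1 → I0
  lam_injective : Function.Injective lam

namespace KiteFrame

variable (F : KiteFrame.{u})

/-- The sets `I_n`: `I_0` is everything and `I_{n+1} = {i ∈ I_n | i ∈ I_1 and lam i ∈ I_n}`.
For `n = 0` this gives back `I1`, see `level_one`. -/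
def level : ℕ → Set F.I0
  | 0 => Set.univ
  | n + 1 => {i | i ∈ level n ∧ ∃ h : i ∈ F.I1, F.lam ⟨i, h⟩ ∈ level n}

theorem level_one : F.level 1 = F.I1 :=
  Set.ext fun _ => ⟨fun h => h.2.1, fun h => ⟨trivial, h, trivial⟩⟩

open Classical in
/-- `lam` as a total function, with the irrelevant value `i` outside `I1`. Its `n`-th iterate is
used only on `I_n`, where it is the `n`-th iterate of `lam`. -/
noncomputable def step (i : F.I0) : F.I0 :=
  if h : i ∈ F.I1 then F.lam ⟨i, h⟩ else i

theorem mem_level_succ {n : ℕ} {i : F.I0} :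
    i ∈ F.level (n + 1) ↔ i ∈ F.level n ∧ i ∈ F.I1 ∧ F.step i ∈ F.level n := by
  constructor
  · rintro ⟨h, h1, h2⟩
    refine ⟨h, h1, ?_⟩
    rw [step, dif_pos h1]
    exact h2
  · rintro ⟨h, h1, h2⟩
    rw [step, dif_pos h1] at h2
    exact ⟨h, h1, h2⟩

/-- `I_{n+1}` is the set of `i ∈ I1` with `lam i ∈ I_n`. -/
theorem mem_level_succ' {n : ℕ} {i : F.I0} :
    i ∈ F.level (n + 1) ↔ i ∈ F.I1 ∧ F.step i ∈ F.level n := by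
  induction n generalizing i with
  | zero => rw [mem_level_succ]; exact ⟨fun h => h.2, fun h => ⟨trivial, h⟩⟩
  | succ n ih =>
    rw [mem_level_succ]
    refine ⟨fun h => h.2, fun h => ⟨?_, h⟩⟩
    exact ih.2 ⟨h.1, (F.mem_level_succ.1 h.2).1⟩

/-- `I_{m+n}` is the set of `i ∈ I_n` with `lam^n i ∈ I_m`. -/
theorem mem_level_add {m n : ℕ} {i : F.I0} :
    i ∈ F.level (m + n) ↔ i ∈ F.level n ∧ F.step^[n] i ∈ F.level m := by
  induction n generalizing i with
  | zero => exact ⟨fun h => ⟨trivial, h⟩, fun h => h.2⟩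
  | succ n ih =>
    rw [← Nat.add_assoc, mem_level_succ', ih, mem_level_succ', Function.iterate_succ_apply]
    tauto

theorem mem_right {m n : ℕ} {i : F.I0} (h : i ∈ F.level (m + n)) : i ∈ F.level n :=
  (F.mem_level_add.1 h).1

theorem iterate_mem {m n : ℕ} {i : F.I0} (h : i ∈ F.level (m + n)) :
    F.step^[n] i ∈ F.level m :=
  (F.mem_level_add.1 h).2

theorem iterate_mem_of_le {m n : ℕ} (hnm : n ≤ m) {i : F.I0} (h : i ∈ F.level m) :
    F.step^[m - n] i ∈ F.level n :=
  F.iterate_mem (by rwa [Nat.add_sub_cancel' hnm])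

theorem iterate_inj {n : ℕ} {i j : F.I0} (hi : i ∈ F.level n) (hj : j ∈ F.level n)
    (h : F.step^[n] i = F.step^[n] j) : i = j := by
  induction n generalizing i j with
  | zero => exact h
  | succ n ih =>
    rw [mem_level_succ'] at hi hj
    rw [Function.iterate_succ_apply, Function.iterate_succ_apply] at h
    have h' := ih hi.2 hj.2 h
    rw [step, step, dif_pos hi.1, dif_pos hj.1] at h'
    exact congrArg Subtype.val (F.lam_injective h')

end KiteFrame

/-- The underlying set of the kite: the disjoint union over `n` of the powers `G^{I_n}`. -/
structure Kite (F : KiteFrame.{u}) (G : Type u) : Type u where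
  lvl : ℕ
  coord : F.level lvl → G

namespace Kite

variable {F : KiteFrame.{u}} {G : Type u}

theorem ext_coord {x y : Kite F G} (h : x.lvl = y.lvl)
    (hc : ∀ i hx hy, x.coord ⟨i, hx⟩ = y.coord ⟨i, hy⟩) : x = y := by
  obtain ⟨m, x⟩ := x
  obtain ⟨n, y⟩ := y
  obtain rfl : m = n := h
  congr
  funext i
  exact hc i.1 i.2 i.2

variable [IntegralResiduatedLattice G]

/-- The lexicographic order: deeper levels are smaller, each level is ordered coordinatewise. -/
instance : PartialOrder (Kite F G) where
  le x y := y.lvl < x.lvl ∨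
    (x.lvl = y.lvl ∧ ∀ i hx hy, x.coord ⟨i, hx⟩ ≤ y.coord ⟨i, hy⟩)
  le_refl x := Or.inr ⟨rfl, fun _ _ _ => le_rfl⟩
  le_trans x y z := by
    rintro (h | ⟨h, hc⟩) (k | ⟨k, kc⟩)
    · exact Or.inl (k.trans h)
    · exact Or.inl (k ▸ h)
    · exact Or.inl (h ▸ k)
    · exact Or.inr ⟨h.trans k, fun i hx hz => (hc i hx (h ▸ hx)).trans (kc i (h ▸ hx) hz)⟩
  le_antisymm x y := by
    rintro (h | ⟨h, hc⟩) (k | ⟨k, kc⟩)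
    · omega
    · omega
    · omega
    · exact ext_coord h fun i hx hy => le_antisymm (hc i hx hy) (kc i hy hx)

theorem le_def {x y : Kite F G} : x ≤ y ↔ y.lvl < x.lvl ∨
    (x.lvl = y.lvl ∧ ∀ i hx hy, x.coord ⟨i, hx⟩ ≤ y.coord ⟨i, hy⟩) := Iff.rfl

/-- The lattice operations of the lexicographic order: coordinatewise on each level. -/
instance : Lattice (Kite F G) where
  sup x y :=
    if h : x.lvl = y.lvl then ⟨x.lvl, fun i => x.coord i ⊔ y.coord ⟨i.1, h ▸ i.2⟩⟩
    else if x.lvl < y.lvl then x else y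
  inf x y :=
    if h : x.lvl = y.lvl then ⟨x.lvl, fun i => x.coord i ⊓ y.coord ⟨i.1, h ▸ i.2⟩⟩
    else if x.lvl < y.lvl then y else x
  le_sup_left x y := by
    split_ifs with h h'
    · exact Or.inr ⟨rfl, fun i hx hy => le_sup_left⟩
    · exact le_rfl
    · exact Or.inl (by omega)
  le_sup_right x y := by
    split_ifs with h h'
    · exact Or.inr ⟨h.symm, fun i hx hy => le_sup_right⟩
    · exact Or.inl h'
    · exact le_rfl
  sup_le x y z := by
    intro hx hy
    split_ifs with h h'
    · rcases hx with hx | ⟨hx, hxc⟩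
      · exact Or.inl hx
      · rcases hy with hy | ⟨hy, hyc⟩
        · exact Or.inl (show z.lvl < x.lvl by omega)
        · exact Or.inr ⟨hx, fun i hi hz => sup_le (hxc i hi hz) (hyc i (h ▸ hi) hz)⟩
    · exact hx
    · exact hy
  inf_le_left x y := by
    split_ifs with h h'
    · exact Or.inr ⟨rfl, fun i hx hy => inf_le_left⟩
    · exact Or.inl h'
    · exact le_rfl
  inf_le_right x y := by
    split_ifs with h h'
    · exact Or.inr ⟨h, fun i hx hy => inf_le_right⟩
    · exact le_rfl
    · exact Or.inl (by omega)
  le_inf z x y := by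
    intro hx hy
    split_ifs with h h'
    · rcases hx with hx | ⟨hx, hxc⟩
      · exact Or.inl hx
      · rcases hy with hy | ⟨hy, hyc⟩
        · exact Or.inl (show x.lvl < z.lvl by omega)
        · exact Or.inr ⟨hx, fun i hz hi => le_inf (hxc i hz hi) (hyc i hz (h ▸ hi))⟩
    · exact hy
    · exact hx

/-- The product: `⟨x_i : i ∈ I_m⟩ * ⟨y_i : i ∈ I_n⟩ = ⟨x_{lam^n i} * y_i : i ∈ I_{m+n}⟩`; the unit is
the constant family `e` on `I_0`. -/
noncomputable instance : Monoid (Kite F G) where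
  mul x y := ⟨x.lvl + y.lvl, fun i =>
    x.coord ⟨F.step^[y.lvl] i.1, F.iterate_mem i.2⟩ * y.coord ⟨i.1, F.mem_right i.2⟩⟩
  one := ⟨0, fun _ => 1⟩
  mul_assoc x y z := by
    refine ext_coord (Nat.add_assoc _ _ _) fun i hx hy => ?_
    change x.coord ⟨F.step^[y.lvl] (F.step^[z.lvl] i), _⟩ * y.coord ⟨F.step^[z.lvl] i, _⟩
        * z.coord ⟨i, _⟩ =
      x.coord ⟨F.step^[y.lvl + z.lvl] i, _⟩ * (y.coord ⟨F.step^[z.lvl] i, _⟩ * z.coord ⟨i, _⟩)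
    rw [mul_assoc]
    simp only [Function.iterate_add_apply]
  one_mul x := ext_coord (Nat.zero_add _) fun i hx hy => one_mul _
  mul_one x := ext_coord (Nat.add_zero _) fun i hx hy => mul_one _

open Classical in
/-- The left division `y \ x` for `y` on level `n` and `x` on level `m`. If `n ≤ m` it is on level
`m - n`, with value `y_{lam^{m-n} i} \ x_i` for `i ∈ I_m` and `e` for the other `i ∈ I_{m-n}`;
otherwise it is `1`. -/
noncomputable def ld (y x : Kite F G) : Kite F G :=
  if hle : y.lvl ≤ x.lvl then
    ⟨x.lvl - y.lvl, fun i =>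
      if hi : i.1 ∈ F.level x.lvl then
        ldiv (y.coord ⟨F.step^[x.lvl - y.lvl] i.1, F.iterate_mem_of_le hle hi⟩) (x.coord ⟨i.1, hi⟩)
      else 1⟩
  else 1

open Classical in
/-- The right division `y / x` for `y` on level `n` and `x` on level `m`. If `m ≤ n` it is on level
`n - m`, with value `y_j / x_j` at `i = lam^m j`, `j ∈ I_n` (such a `j` is unique), and `e` at those
`i ∈ I_{n-m}` that are not of this form; otherwise it is `1`. -/
noncomputable def rd (y x : Kite F G) : Kite F G :=
  if hle : x.lvl ≤ y.lvl then
    ⟨y.lvl - x.lvl, fun i =>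
      if hi : ∃ j, j ∈ F.level y.lvl ∧ F.step^[x.lvl] j = i.1 then
        rdiv (y.coord ⟨hi.choose, hi.choose_spec.1⟩)
          (x.coord ⟨hi.choose, F.mem_right (m := y.lvl - x.lvl)
            (by rw [Nat.sub_add_cancel hle]; exact hi.choose_spec.1)⟩)
      else 1⟩
  else 1

theorem le_one_kite (x : Kite F G) : x ≤ 1 := by
  rcases Nat.eq_zero_or_pos x.lvl with h | h
  · exact Or.inr ⟨h, fun i _ _ => le_one' _⟩
  · exact Or.inl h

theorem mul_le_iff_le_ld (x y z : Kite F G) : x * y ≤ z ↔ y ≤ ld x z := by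
  obtain ⟨m, x⟩ := x
  obtain ⟨n, y⟩ := y
  obtain ⟨r, z⟩ := z
  rcases lt_trichotomy r (m + n) with h | h | h
  · refine ⟨fun _ => ?_, fun _ => Or.inl h⟩
    unfold ld
    split_ifs with hle
    · exact Or.inl (by change r - m < n; dsimp only at hle; omega)
    · exact le_one_kite _
  · subst h
    have hle : m ≤ m + n := Nat.le_add_right m n
    have hs : m + n - m = n := Nat.add_sub_cancel_left m n
    unfold ld
    rw [dif_pos hle]
    constructor
    · rintro (hl | ⟨-, hc⟩)
      · exact absurd hl (lt_irrefl _)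
      · refine Or.inr ⟨hs.symm, fun i hi hi' => ?_⟩
        dsimp only
        split_ifs with hz
        · rw [← mul_le_iff_le_ldiv]
          simp only [hs]
          exact hc i hz hz
        · exact le_one' _
    · rintro (hl | ⟨-, hc⟩)
      · exact absurd hl (by change ¬ (m + n - m < n); omega)
      · refine Or.inr ⟨rfl, fun i hi hz => ?_⟩
        have hc' := hc i (F.mem_right hi) (by change i ∈ F.level (m + n - m); rw [hs]; exact F.mem_right hi)
        dsimp only at hc'
        rw [dif_pos hz, ← mul_le_iff_le_ldiv] at hc'
        simp only [hs] at hc'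
        exact hc'
  · constructor
    · rintro (hl | ⟨hl, -⟩)
      · change r < m + n at hl
        omega
      · change m + n = r at hl
        omega
    · have hle : m ≤ r := by omega
      unfold ld
      rw [dif_pos hle]
      rintro (hl | ⟨hl, -⟩)
      · change r - m < n at hl
        omega
      · change n = r - m at hl
        omega

theorem mul_le_iff_le_rd (x y z : Kite F G) : x * y ≤ z ↔ x ≤ rd z y := by
  obtain ⟨m, x⟩ := x
  obtain ⟨n, y⟩ := y
  obtain ⟨r, z⟩ := z
  rcases lt_trichotomy r (m + n) with h | h | h
  · refine ⟨fun _ => ?_, fun _ => Or.inl h⟩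
    unfold rd
    split_ifs with hle
    · exact Or.inl (by change r - n < m; dsimp only at hle; omega)
    · exact le_one_kite _
  · subst h
    have hle : n ≤ m + n := Nat.le_add_left n m
    have hs : m + n - n = m := Nat.add_sub_cancel m n
    unfold rd
    rw [dif_pos hle]
    constructor
    · rintro (hl | ⟨-, hc⟩)
      · exact absurd hl (lt_irrefl _)
      · refine Or.inr ⟨hs.symm, fun i hi hi' => ?_⟩
        dsimp only
        split_ifs with hz
        · rw [← mul_le_iff_le_rdiv]
          have hj := hz.choose_spec
          have := hc hz.choose hj.1 hj.1
          change x ⟨F.step^[n] hz.choose, _⟩ * y ⟨hz.choose, _⟩ ≤ _ at this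
          simp only [hj.2] at this
          exact this
        · exact le_one' _
    · rintro (hl | ⟨-, hc⟩)
      · exact absurd hl (by change ¬ (m + n - n < m); omega)
      · refine Or.inr ⟨rfl, fun i hi hz => ?_⟩
        have hm : F.step^[n] i ∈ F.level m := F.iterate_mem hi
        have hc' := hc (F.step^[n] i) hm (by change _ ∈ F.level (m + n - n); rwa [hs])
        have hex : ∃ j, j ∈ F.level (m + n) ∧ F.step^[n] j = F.step^[n] i := ⟨i, hz, rfl⟩
        have hj : hex.choose = i :=
          F.iterate_inj (F.mem_right hex.choose_spec.1) (F.mem_right hz) hex.choose_spec.2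
        dsimp only at hc'
        rw [dif_pos hex, ← mul_le_iff_le_rdiv] at hc'
        simp only [hj] at hc'
        exact hc'
  · constructor
    · rintro (hl | ⟨hl, -⟩)
      · change r < m + n at hl
        omega
      · change m + n = r at hl
        omega
    · have hle : n ≤ r := by omega
      unfold rd
      rw [dif_pos hle]
      rintro (hl | ⟨hl, -⟩)
      · change r - n < m at hl
        omega
      · change m = r - n at hl
        omega

/-- The kite residuated lattice over `G` with index data `F`. -/
noncomputable instance : IntegralResiduatedLattice (Kite F G) where
  ldiv := ld
  rdiv := rd
  mul_le_iff_le_ldiv := mul_le_iff_le_ld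
  mul_le_iff_le_rdiv := mul_le_iff_le_rd
  le_one' := le_one_kite

end Kite

/-- The class of all kites. -/
def kites : Set IRL.{u} :=
  {A | ∃ (F : KiteFrame.{u}) (G : IRL.{u}), A = IRL.mk (Kite F G.carrier)}

/-- The class of all `n`-dimensional kites: those whose set `I0` is finite with `n` elements. -/
def kitesOfDim (n : ℕ) : Set IRL.{u} :=
  {A | ∃ (F : KiteFrame.{u}) (G : IRL.{u}), Finite F.I0 ∧ Nat.card F.I0 = n ∧
    A = IRL.mk (Kite F G.carrier)}

/-- The variety generated by all kites. -/
def kiteVariety : IRLVariety.{u} := IRLVariety.generatedBy kites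

/-- The variety generated by all `n`-dimensional kites. -/
def kiteVarietyOfDim (n : ℕ) : IRLVariety.{u} := IRLVariety.generatedBy (kitesOfDim n)

/-!
Every kite is a homomorphic image of a subalgebra of a product of finite-dimensional kites, so it
lies in any variety that contains the latter.

Fix a kite over `G` with index data `F`. For each finite `T ⊆ I0` let `F.restrict T` be the index
set `T` with the part of the injection `lam` that stays inside `T`. A family `p`, indexed by the
finite sets `T`, of elements of the kites over `F.restrict T` *converges* to an element `a` of the
kite over `F` if, for all large enough `T`, `p T` is on the level of `a`, and if, for every index `i`
at which `a` has a coordinate, `p T` has the same coordinate at `i` for all large enough `T`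
(depending on `i`). Each coordinate of the result of an operation in a kite depends on only finitely
many coordinates of the arguments, so convergence is compatible with all six operations
(`Kite.Converges.mul`, `Kite.Converges.ldiv`, `Kite.Converges.rdiv` and so on). Limits are unique,
and every `a` is the limit of its restrictions (`Kite.exists_converges`). So the convergent families
form a subalgebra of the product that the limit maps onto the kite over `F`.
-/

open Filter

/-! ### Homomorphic images of subalgebras -/

namespace IRLVariety

theorem subset_generatedBy (C : Set IRL.{u}) : C ⊆ (generatedBy C).algebras :=
  fun _ hA _ hV => hV hA

theorem generatedBy_le {C : Set IRL.{u}} {V : IRLVariety.{u}} (h : C ⊆ V.algebras) :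
    generatedBy C ≤ V :=
  sInf_le h

/-- If a relation between `A` and `B` is compatible with the operations, and is the graph of a
partial function from `A` onto `B`, then `B` is a homomorphic image of a subalgebra of `A`. Working
with the graph, as a subalgebra of `A × B`, avoids choosing values of the function. -/
theorem mem_of_rel (V : IRLVariety.{u}) {A B : IRL.{u}} (hA : A ∈ V.algebras)
    (R : A.carrier → B.carrier → Prop)
    (inf : ∀ {x y a b}, R x a → R y b → R (x ⊓ y) (a ⊓ b))
    (sup : ∀ {x y a b}, R x a → R y b → R (x ⊔ y) (a ⊔ b))
    (mul : ∀ {x y a b}, R x a → R y b → R (x * y) (a * b))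
    (ldiv : ∀ {x y a b}, R x a → R y b → R (ldiv x y) (ldiv a b))
    (rdiv : ∀ {x y a b}, R x a → R y b → R (rdiv x y) (rdiv a b))
    (one : R 1 1)
    (unique : ∀ {x a b}, R x a → R x b → a = b)
    (surj : ∀ a, ∃ x, R x a) : B ∈ V.algebras := by
  let S := {q : A.carrier × B.carrier // R q.1 q.2}
  let lat : Lattice S := Subtype.lattice (fun _ _ hx hy => sup hx hy) (fun _ _ hx hy => inf hx hy)
  let irl : IntegralResiduatedLattice S :=
    { lat with
      mul := fun x y => ⟨(x.1.1 * y.1.1, x.1.2 * y.1.2), mul x.2 y.2⟩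
      one := ⟨(1, 1), one⟩
      mul_assoc := fun x y z => Subtype.ext (mul_assoc x.1 y.1 z.1)
      one_mul := fun x => Subtype.ext (one_mul x.1)
      mul_one := fun x => Subtype.ext (mul_one x.1)
      ldiv := fun x y => ⟨(IntegralResiduatedLattice.ldiv x.1.1 y.1.1,
        IntegralResiduatedLattice.ldiv x.1.2 y.1.2), ldiv x.2 y.2⟩
      rdiv := fun x y => ⟨(IntegralResiduatedLattice.rdiv x.1.1 y.1.1,
        IntegralResiduatedLattice.rdiv x.1.2 y.1.2), rdiv x.2 y.2⟩
      mul_le_iff_le_ldiv := fun x y z =>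
        and_congr (mul_le_iff_le_ldiv x.1.1 y.1.1 z.1.1) (mul_le_iff_le_ldiv x.1.2 y.1.2 z.1.2)
      mul_le_iff_le_rdiv := fun x y z =>
        and_congr (mul_le_iff_le_rdiv x.1.1 y.1.1 z.1.1) (mul_le_iff_le_rdiv x.1.2 y.1.2 z.1.2)
      le_one' := fun x => ⟨le_one' x.1.1, le_one' x.1.2⟩ }
  let fst : IRLHom S A.carrier := ⟨fun q => q.1.1, fun _ _ => rfl, fun _ _ => rfl, fun _ _ => rfl,
    fun _ _ => rfl, fun _ _ => rfl, rfl⟩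
  let snd : IRLHom S B.carrier := ⟨fun q => q.1.2, fun _ _ => rfl, fun _ _ => rfl, fun _ _ => rfl,
    fun _ _ => rfl, fun _ _ => rfl, rfl⟩
  have fst_injective : Function.Injective fst.toFun := by
    rintro ⟨⟨x, a⟩, ha⟩ ⟨⟨y, b⟩, hb⟩ (rfl : x = y)
    obtain rfl : a = b := unique ha hb
    rfl
  have snd_surjective : Function.Surjective snd.toFun := fun a =>
    let ⟨x, hx⟩ := surj a
    ⟨⟨(x, a), hx⟩, rfl⟩
  exact V.image_mem (IRL.mk S) B snd snd_surjective (V.sub_mem (IRL.mk S) A fst fst_injective hA)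

end IRLVariety

/-! ### Restriction of the index data to a finite set -/

namespace KiteFrame

variable (F : KiteFrame.{u})

/-- The index data on a finite set `T` of indices: `lam i` remains defined for those `i ∈ T` with
`lam i ∈ T`. -/
def restrict (T : Finset F.I0) : KiteFrame.{u} where
  I0 := T
  I1 := {i | ∃ h : i.1 ∈ F.I1, F.lam ⟨i.1, h⟩ ∈ T}
  lam i := ⟨F.lam ⟨i.1.1, i.2.1⟩, i.2.2⟩
  lam_injective i j h := by
    have h' := F.lam_injective (congrArg Subtype.val h)
    exact Subtype.ext (Subtype.ext (Subtype.mk.inj h'))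

variable {F} {T : Finset F.I0}

theorem mem_I1_of_mem_restrict {i : (F.restrict T).I0} (h : i ∈ (F.restrict T).I1) :
    i.1 ∈ F.I1 := h.1

theorem restrict_step {i : (F.restrict T).I0} (h : i ∈ (F.restrict T).I1) :
    ((F.restrict T).step i).1 = F.step i.1 := by
  rw [step, step, dif_pos h, dif_pos (mem_I1_of_mem_restrict h)]
  rfl

theorem mem_level_of_mem_restrict {n : ℕ} {i : (F.restrict T).I0}
    (h : i ∈ (F.restrict T).level n) : i.1 ∈ F.level n := by
  induction n generalizing i with
  | zero => trivial
  | succ n ih =>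
    rw [mem_level_succ'] at h ⊢
    exact ⟨mem_I1_of_mem_restrict h.1, restrict_step h.1 ▸ ih h.2⟩

theorem restrict_iterate {n : ℕ} {i : (F.restrict T).I0}
    (h : i ∈ (F.restrict T).level n) :
    ((F.restrict T).step^[n] i).1 = F.step^[n] i.1 := by
  induction n generalizing i with
  | zero => rfl
  | succ n ih =>
    rw [mem_level_succ'] at h
    rw [Function.iterate_succ_apply, Function.iterate_succ_apply, ih h.2, restrict_step h.1]

/-- It suffices that `T` contains `i, lam i, …, lam^n i`. -/
theorem eventually_mem_restrict_level {n : ℕ} {i : F.I0} (hi : i ∈ F.level n) :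
    ∀ᶠ T : Finset F.I0 in atTop, ∃ h : i ∈ T, (⟨i, h⟩ : T) ∈ (F.restrict T).level n := by
  have hmem (j : F.I0) : ∀ᶠ T : Finset F.I0 in atTop, j ∈ T := by
    filter_upwards [eventually_ge_atTop {j}] with T hT
    exact hT (Finset.mem_singleton_self j)
  induction n generalizing i with
  | zero =>
    filter_upwards [hmem i] with T hT
    exact ⟨hT, trivial⟩
  | succ n ih =>
    rw [mem_level_succ'] at hi
    filter_upwards [hmem i, ih hi.2] with T hT ⟨hs, hl⟩
    have h1 : (⟨i, hT⟩ : T) ∈ (F.restrict T).I1 :=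
      ⟨hi.1, by rwa [step, dif_pos hi.1] at hs⟩
    refine ⟨hT, (mem_level_succ' _).2 ⟨h1, ?_⟩⟩
    have : (F.restrict T).step ⟨i, hT⟩ = (⟨F.step i, hs⟩ : T) := Subtype.ext (restrict_step h1)
    rwa [this]

end KiteFrame

/-! ### Convergence of families in the restricted kites -/

namespace Kite

variable {F : KiteFrame.{u}} {G : Type u}

/-- `p` has a coordinate at `i`, namely `g`. -/
def HasCoord {F : KiteFrame.{u}} (p : Kite F G) (i : F.I0) (g : G) : Prop :=
  ∃ h : i ∈ F.level p.lvl, p.coord ⟨i, h⟩ = g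

/-- The family `p` in the kites over the finite restrictions of `F` converges to `a`: its levels are
eventually that of `a`, and each coordinate of `a` is eventually a coordinate of `p T`. The second
condition is pointwise: how large `T` has to be may depend on the coordinate. -/
structure Converges (p : ∀ T : Finset F.I0, Kite (F.restrict T) G) (a : Kite F G) : Prop where
  lvl : ∀ᶠ T in atTop, (p T).lvl = a.lvl
  coord : ∀ i g, a.HasCoord i g →
    ∀ᶠ T in atTop, ∃ h : i ∈ T, (p T).HasCoord ⟨i, h⟩ g

theorem HasCoord.unique {a : Kite F G} {i : F.I0} {g g' : G} (h : a.HasCoord i g)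
    (h' : a.HasCoord i g') : g = g' := by
  obtain ⟨-, rfl⟩ := h
  obtain ⟨-, rfl⟩ := h'
  rfl

theorem Converges.unique {p : ∀ T : Finset F.I0, Kite (F.restrict T) G} {a b : Kite F G}
    (ha : Converges p a) (hb : Converges p b) : a = b := by
  obtain ⟨T, hT, hT'⟩ := (ha.lvl.and hb.lvl).exists
  refine ext_coord (hT.symm.trans hT') fun i hi hi' => ?_
  obtain ⟨T, ⟨_, h⟩, ⟨_, h'⟩⟩ := ((ha.coord i _ ⟨hi, rfl⟩).and (hb.coord i _ ⟨hi', rfl⟩)).exists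
  exact h.unique h'

theorem exists_converges (a : Kite F G) :
    ∃ p : ∀ T : Finset F.I0, Kite (F.restrict T) G, Converges p a := by
  refine ⟨fun T => ⟨a.lvl, fun i => a.coord ⟨i.1.1, KiteFrame.mem_level_of_mem_restrict i.2⟩⟩,
    Eventually.of_forall fun _ => rfl, ?_⟩
  rintro i _ ⟨hi, rfl⟩
  filter_upwards [KiteFrame.eventually_mem_restrict_level hi] with T ⟨h, h'⟩
  exact ⟨h, h', rfl⟩

theorem Converges.congr {p q : ∀ T : Finset F.I0, Kite (F.restrict T) G} {a : Kite F G}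
    (ha : Converges p a) (h : ∀ᶠ T in atTop, p T = q T) : Converges q a where
  lvl := by
    filter_upwards [ha.lvl, h] with T h1 h2
    rwa [← h2]
  coord i g hg := by
    filter_upwards [ha.coord i g hg, h] with T h1 h2
    rwa [← h2]

variable [IntegralResiduatedLattice G]

/-! ### Coordinates of the results of the operations -/

theorem sup_of_lvl_lt {x y : Kite F G} (h : x.lvl < y.lvl) : x ⊔ y = x :=
  sup_eq_left.2 (Or.inl h)

theorem inf_of_lvl_lt {x y : Kite F G} (h : x.lvl < y.lvl) : x ⊓ y = y :=
  inf_eq_right.2 (Or.inl h)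

theorem sup_of_lvl_eq {x y : Kite F G} (h : x.lvl = y.lvl) :
    x ⊔ y = ⟨x.lvl, fun i => x.coord i ⊔ y.coord ⟨i.1, h ▸ i.2⟩⟩ :=
  dif_pos h

theorem inf_of_lvl_eq {x y : Kite F G} (h : x.lvl = y.lvl) :
    x ⊓ y = ⟨x.lvl, fun i => x.coord i ⊓ y.coord ⟨i.1, h ▸ i.2⟩⟩ :=
  dif_pos h

theorem HasCoord.sup {x y : Kite F G} (h : x.lvl = y.lvl) {i : F.I0} {a b : G}
    (hx : x.HasCoord i a) (hy : y.HasCoord i b) : (x ⊔ y).HasCoord i (a ⊔ b) := by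
  obtain ⟨hi, rfl⟩ := hx
  obtain ⟨_, rfl⟩ := hy
  rw [sup_of_lvl_eq h]
  exact ⟨hi, rfl⟩

theorem HasCoord.inf {x y : Kite F G} (h : x.lvl = y.lvl) {i : F.I0} {a b : G}
    (hx : x.HasCoord i a) (hy : y.HasCoord i b) : (x ⊓ y).HasCoord i (a ⊓ b) := by
  obtain ⟨hi, rfl⟩ := hx
  obtain ⟨_, rfl⟩ := hy
  rw [inf_of_lvl_eq h]
  exact ⟨hi, rfl⟩

theorem lvl_mul (x y : Kite F G) : (x * y).lvl = x.lvl + y.lvl := rfl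

theorem hasCoord_one (i : F.I0) : (1 : Kite F G).HasCoord i 1 := ⟨trivial, rfl⟩

theorem HasCoord.mul {x y : Kite F G} {i : F.I0} (hi : i ∈ F.level (x.lvl + y.lvl)) {a b : G}
    (hx : x.HasCoord (F.step^[y.lvl] i) a) (hy : y.HasCoord i b) :
    (x * y).HasCoord i (a * b) := by
  obtain ⟨_, rfl⟩ := hx
  obtain ⟨_, rfl⟩ := hy
  exact ⟨hi, rfl⟩

theorem ldiv_of_lt {y x : Kite F G} (h : x.lvl < y.lvl) : ldiv y x = 1 :=
  dif_neg (not_le.2 h)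

theorem rdiv_of_lt {y x : Kite F G} (h : y.lvl < x.lvl) : rdiv y x = 1 :=
  dif_neg (not_le.2 h)

/-- This holds also for `x.lvl < y.lvl`, since both sides are then `0`. -/
theorem lvl_ldiv (y x : Kite F G) : (ldiv y x).lvl = x.lvl - y.lvl := by
  rcases lt_or_ge x.lvl y.lvl with h | h
  · rw [ldiv_of_lt h, Nat.sub_eq_zero_of_le h.le]
    rfl
  · exact congrArg Kite.lvl (dif_pos h)

/-- This holds also for `y.lvl < x.lvl`, since both sides are then `0`. -/
theorem lvl_rdiv (y x : Kite F G) : (rdiv y x).lvl = y.lvl - x.lvl := by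
  rcases lt_or_ge y.lvl x.lvl with h | h
  · rw [rdiv_of_lt h, Nat.sub_eq_zero_of_le h.le]
    rfl
  · exact congrArg Kite.lvl (dif_pos h)

theorem HasCoord.ldiv {y x : Kite F G} (hle : y.lvl ≤ x.lvl) {i : F.I0} {b a : G}
    (hy : y.HasCoord (F.step^[x.lvl - y.lvl] i) b) (hx : x.HasCoord i a) :
    (ldiv y x).HasCoord i (ldiv b a) := by
  obtain ⟨_, rfl⟩ := hy
  obtain ⟨hi, rfl⟩ := hx
  have hd : i ∈ F.level (x.lvl - y.lvl) :=
    F.mem_right (m := y.lvl) (by rwa [Nat.add_sub_cancel' hle])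
  change (ld y x).HasCoord i _
  rw [ld, dif_pos hle]
  exact ⟨hd, dif_pos hi⟩

theorem hasCoord_ldiv_one {y x : Kite F G} (hle : y.lvl ≤ x.lvl) {i : F.I0}
    (hd : i ∈ F.level (x.lvl - y.lvl)) (hi : i ∉ F.level x.lvl) :
    (ldiv y x).HasCoord i 1 := by
  change (ld y x).HasCoord i _
  rw [ld, dif_pos hle]
  exact ⟨hd, dif_neg hi⟩

theorem HasCoord.rdiv {y x : Kite F G} (hle : x.lvl ≤ y.lvl) {j : F.I0} {b a : G}
    (hy : y.HasCoord j b) (hx : x.HasCoord j a) :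
    (rdiv y x).HasCoord (F.step^[x.lvl] j) (rdiv b a) := by
  obtain ⟨hj, rfl⟩ := hy
  obtain ⟨hj', rfl⟩ := hx
  have hd : F.step^[x.lvl] j ∈ F.level (y.lvl - x.lvl) :=
    F.iterate_mem (by rwa [Nat.sub_add_cancel hle])
  have hex : ∃ k, k ∈ F.level y.lvl ∧ F.step^[x.lvl] k = F.step^[x.lvl] j := ⟨j, hj, rfl⟩
  have hk : hex.choose = j := F.iterate_inj
    (F.mem_right (m := y.lvl - x.lvl)
      (by rw [Nat.sub_add_cancel hle]; exact hex.choose_spec.1)) hj' hex.choose_spec.2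
  change (rd y x).HasCoord _ _
  rw [rd, dif_pos hle]
  refine ⟨hd, (dif_pos hex).trans ?_⟩
  simp only [hk]

theorem hasCoord_rdiv_one {y x : Kite F G} (hle : x.lvl ≤ y.lvl) {i : F.I0}
    (hd : i ∈ F.level (y.lvl - x.lvl))
    (hi : ¬ ∃ j, j ∈ F.level y.lvl ∧ F.step^[x.lvl] j = i) :
    (rdiv y x).HasCoord i 1 := by
  change (rd y x).HasCoord i _
  rw [rd, dif_pos hle]
  exact ⟨hd, dif_neg hi⟩

/-! ### Convergence is compatible with the operations -/

namespace Converges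

variable {p q : ∀ T : Finset F.I0, Kite (F.restrict T) G} {a b : Kite F G}

theorem one : Converges (1 : ∀ T : Finset F.I0, Kite (F.restrict T) G) (1 : Kite F G) where
  lvl := Eventually.of_forall fun _ => rfl
  coord i g hg := by
    obtain rfl := hg.unique (hasCoord_one i)
    filter_upwards [KiteFrame.eventually_mem_restrict_level (n := 0) (i := i) trivial]
      with T ⟨h, _⟩
    exact ⟨h, hasCoord_one _⟩

theorem sup (ha : Converges p a) (hb : Converges q b) : Converges (p ⊔ q) (a ⊔ b) := by
  have hlvl := ha.lvl.and hb.lvl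
  rcases lt_trichotomy a.lvl b.lvl with h | h | h
  · rw [sup_of_lvl_lt h]
    refine ha.congr (hlvl.mono fun T hT => ?_)
    rw [Pi.sup_apply, sup_of_lvl_lt (by omega)]
  · constructor
    · filter_upwards [hlvl] with T hT
      rw [Pi.sup_apply, sup_of_lvl_eq (by omega), sup_of_lvl_eq h]
      exact hT.1
    · intro i g hg
      have hi : i ∈ F.level a.lvl := by
        rw [sup_of_lvl_eq h] at hg
        exact hg.1
      obtain rfl := hg.unique (HasCoord.sup h ⟨hi, rfl⟩ ⟨h ▸ hi, rfl⟩)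
      filter_upwards [hlvl, ha.coord i _ ⟨hi, rfl⟩, hb.coord i _ ⟨h ▸ hi, rfl⟩]
        with T hT ⟨hm, hp⟩ ⟨_, hq⟩
      exact ⟨hm, hp.sup (by omega) hq⟩
  · rw [sup_comm a, sup_of_lvl_lt h]
    refine hb.congr (hlvl.mono fun T hT => ?_)
    rw [Pi.sup_apply, sup_comm, sup_of_lvl_lt (by omega)]

theorem inf (ha : Converges p a) (hb : Converges q b) : Converges (p ⊓ q) (a ⊓ b) := by
  have hlvl := ha.lvl.and hb.lvl
  rcases lt_trichotomy a.lvl b.lvl with h | h | h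
  · rw [inf_of_lvl_lt h]
    refine hb.congr (hlvl.mono fun T hT => ?_)
    rw [Pi.inf_apply, inf_of_lvl_lt (by omega)]
  · constructor
    · filter_upwards [hlvl] with T hT
      rw [Pi.inf_apply, inf_of_lvl_eq (by omega), inf_of_lvl_eq h]
      exact hT.1
    · intro i g hg
      have hi : i ∈ F.level a.lvl := by
        rw [inf_of_lvl_eq h] at hg
        exact hg.1
      obtain rfl := hg.unique (HasCoord.inf h ⟨hi, rfl⟩ ⟨h ▸ hi, rfl⟩)
      filter_upwards [hlvl, ha.coord i _ ⟨hi, rfl⟩, hb.coord i _ ⟨h ▸ hi, rfl⟩]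
        with T hT ⟨hm, hp⟩ ⟨_, hq⟩
      exact ⟨hm, hp.inf (by omega) hq⟩
  · rw [inf_comm a, inf_of_lvl_lt h]
    refine ha.congr (hlvl.mono fun T hT => ?_)
    rw [Pi.inf_apply, inf_comm, inf_of_lvl_lt (by omega)]

theorem mul (ha : Converges p a) (hb : Converges q b) : Converges (p * q) (a * b) where
  lvl := by
    filter_upwards [ha.lvl, hb.lvl] with T hp hq
    rw [Pi.mul_apply, lvl_mul, lvl_mul, hp, hq]
  coord i g hg := by
    have hi : i ∈ F.level (a.lvl + b.lvl) := hg.1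
    have ha' : a.HasCoord (F.step^[b.lvl] i) _ := ⟨F.iterate_mem hi, rfl⟩
    have hb' : b.HasCoord i _ := ⟨F.mem_right hi, rfl⟩
    obtain rfl := hg.unique (ha'.mul hi hb')
    filter_upwards [ha.lvl, hb.lvl, ha.coord _ _ ha', hb.coord _ _ hb',
      KiteFrame.eventually_mem_restrict_level hi] with T hp hq ⟨hs, hpc⟩ ⟨hm, hqc⟩ ⟨_, hl⟩
    refine ⟨hm, HasCoord.mul (by rwa [hp, hq]) ?_ hqc⟩
    have hstep : (F.restrict T).step^[b.lvl] ⟨i, hm⟩ = (⟨F.step^[b.lvl] i, hs⟩ : T) :=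
      Subtype.ext (KiteFrame.restrict_iterate (KiteFrame.mem_right _ hl))
    rwa [hq, hstep]

theorem ldiv (ha : Converges p a) (hb : Converges q b) :
    Converges (ldiv p q) (ldiv a b) := by
  have hlvl := ha.lvl.and hb.lvl
  rcases lt_or_ge b.lvl a.lvl with h | h
  · rw [ldiv_of_lt h]
    exact one.congr (hlvl.mono fun T hT => (ldiv_of_lt (by omega)).symm)
  constructor
  · filter_upwards [hlvl] with T hT
    change (IntegralResiduatedLattice.ldiv (p T) (q T)).lvl = _
    rw [lvl_ldiv, lvl_ldiv, hT.1, hT.2]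
  · intro i g hg
    have hd : i ∈ F.level (b.lvl - a.lvl) := lvl_ldiv a b ▸ hg.1
    by_cases hi : i ∈ F.level b.lvl
    · have ha' : a.HasCoord (F.step^[b.lvl - a.lvl] i) _ := ⟨F.iterate_mem_of_le h hi, rfl⟩
      have hb' : b.HasCoord i _ := ⟨hi, rfl⟩
      obtain rfl := hg.unique (ha'.ldiv h hb')
      filter_upwards [hlvl, ha.coord _ _ ha', hb.coord _ _ hb',
        KiteFrame.eventually_mem_restrict_level hd] with T hT ⟨hs, hpc⟩ ⟨hm, hqc⟩ ⟨_, hl⟩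
      refine ⟨hm, HasCoord.ldiv (by omega) ?_ hqc⟩
      have hstep : (F.restrict T).step^[b.lvl - a.lvl] ⟨i, hm⟩ =
          (⟨F.step^[b.lvl - a.lvl] i, hs⟩ : T) := Subtype.ext (KiteFrame.restrict_iterate hl)
      rwa [hT.1, hT.2, hstep]
    · obtain rfl := hg.unique (hasCoord_ldiv_one h hd hi)
      filter_upwards [hlvl, KiteFrame.eventually_mem_restrict_level hd] with T hT ⟨hm, hl⟩
      refine ⟨hm, hasCoord_ldiv_one (by omega) (by rwa [hT.1, hT.2]) fun hi' => hi ?_⟩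
      rw [hT.2] at hi'
      exact KiteFrame.mem_level_of_mem_restrict hi'

theorem rdiv (ha : Converges p a) (hb : Converges q b) :
    Converges (rdiv p q) (rdiv a b) := by
  have hlvl := ha.lvl.and hb.lvl
  rcases lt_or_ge a.lvl b.lvl with h | h
  · rw [rdiv_of_lt h]
    exact one.congr (hlvl.mono fun T hT => (rdiv_of_lt (by omega)).symm)
  constructor
  · filter_upwards [hlvl] with T hT
    change (IntegralResiduatedLattice.rdiv (p T) (q T)).lvl = _
    rw [lvl_rdiv, lvl_rdiv, hT.1, hT.2]
  · intro i g hg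
    have hd : i ∈ F.level (a.lvl - b.lvl) := lvl_rdiv a b ▸ hg.1
    by_cases hi : ∃ j, j ∈ F.level a.lvl ∧ F.step^[b.lvl] j = i
    · obtain ⟨j, hj, rfl⟩ := hi
      have hj' : j ∈ F.level b.lvl :=
        F.mem_right (m := a.lvl - b.lvl) (by rwa [Nat.sub_add_cancel h])
      have ha' : a.HasCoord j _ := ⟨hj, rfl⟩
      have hb' : b.HasCoord j _ := ⟨hj', rfl⟩
      obtain rfl := hg.unique (ha'.rdiv h hb')
      filter_upwards [hlvl, ha.coord _ _ ha', hb.coord _ _ hb',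
        KiteFrame.eventually_mem_restrict_level hj'] with T hT ⟨hm, hpc⟩ ⟨_, hqc⟩ ⟨_, hl⟩
      have hs : F.step^[b.lvl] j ∈ T :=
        KiteFrame.restrict_iterate hl ▸ ((F.restrict T).step^[b.lvl] ⟨j, hm⟩).2
      have hstep : (F.restrict T).step^[b.lvl] ⟨j, hm⟩ = (⟨F.step^[b.lvl] j, hs⟩ : T) :=
        Subtype.ext (KiteFrame.restrict_iterate hl)
      have hpq := hpc.rdiv (by omega) hqc
      rw [hT.2, hstep] at hpq
      exact ⟨hs, hpq⟩
    · obtain rfl := hg.unique (hasCoord_rdiv_one h hd hi)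
      filter_upwards [hlvl, KiteFrame.eventually_mem_restrict_level hd] with T hT ⟨hm, hl⟩
      refine ⟨hm, hasCoord_rdiv_one (by omega) (by rwa [hT.1, hT.2]) ?_⟩
      -- A preimage of `i` in `F.restrict T` would also be one in `F`.
      rintro ⟨j, hj, hji⟩
      rw [hT.1] at hj
      rw [hT.2] at hji
      have hj' : j ∈ (F.restrict T).level b.lvl :=
        KiteFrame.mem_right _ (m := a.lvl - b.lvl) (by rwa [Nat.sub_add_cancel h])
      exact hi ⟨j.1, KiteFrame.mem_level_of_mem_restrict hj,
        (KiteFrame.restrict_iterate hj').symm.trans (congrArg Subtype.val hji)⟩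

end Converges

end Kite

/-! ### The variety generated by kites -/

/-- A variety that contains the kites over `G` with a finite index set contains all kites over `G`,
since the convergent families form a subalgebra of the product of the former. -/
theorem IRLVariety.kite_mem_of_finite (V : IRLVariety.{u}) (F : KiteFrame.{u}) (G : IRL.{u})
    (h : ∀ T : Finset F.I0, IRL.mk (Kite (F.restrict T) G.carrier) ∈ V.algebras) :
    IRL.mk (Kite F G.carrier) ∈ V.algebras :=
  V.mem_of_rel (V.prod_mem (Finset F.I0) _ h) Kite.Converges Kite.Converges.inf
    Kite.Converges.sup Kite.Converges.mul Kite.Converges.ldiv Kite.Converges.rdiv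
    Kite.Converges.one Kite.Converges.unique Kite.exists_converges

theorem corollary6p7 :
    kiteVariety.{u} = ⨆ n : ℕ, kiteVarietyOfDim.{u} n := by
  apply le_antisymm
  · refine IRLVariety.generatedBy_le ?_
    rintro _ ⟨F, G, rfl⟩
    refine IRLVariety.kite_mem_of_finite _ F G fun T => ?_
    refine le_iSup kiteVarietyOfDim T.card (IRLVariety.subset_generatedBy _ ?_)
    refine ⟨F.restrict T, G, inferInstanceAs (Finite T), ?_, rfl⟩
    exact Nat.card_eq_finsetCard T
  · refine iSup_le fun n => IRLVariety.generatedBy_le ?_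
    rintro _ ⟨F, G, -, -, rfl⟩
    exact IRLVariety.subset_generatedBy _ ⟨F, G, rfl⟩
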